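/- Let $K$ be a number field of degree $k$ over $\mathbb{Q}$, with ring of integers $\mathcal{O}_K$ and Dedekind zeta function $\zeta_K$. For an integral basis $\mathbb{E}=\{e_1,\dots,e_k\}$ of $\mathcal{O}_K$ and a real number $B>0$ put $$\mathcal{O}[B,\mathbb{E}]=\Big\{\sum_{i=1}^k a_ie_i \;:\; a_i\in\mathbb{Z},\ -B\le a_i<B\Big\}.$$ A set $S\subseteq\mathcal{O}_K^m$ has density $d$ if, for every integral basis $\mathbb{E}$ of $\mathcal{O}_K$, both the limit superior and the limit inferior, as $B\to\infty$, of $$\frac{|\mathcal{O}[B,\mathbb{E}]^m\cap S|}{(2B)^{mk}}$$ are equal to $d$. An $m$-tuple $(x_1,\dots,x_m)\in\mathcal{O}_K^m$ is coprime if $x_1,\dots,x_m$ generate the unit ideal of $\mathcal{O}_K$. Then for every integer $m\ge 1$ the set of coprime $m$-tuples in $\mathcal{O}_K^m$ has density $\dfrac{1}{\zeta_K(m)}$. Here, for $m\ge 2$, $\zeta_K(m)\neq 0$; for $m=1$, where $\zeta_K$ has a pole, $1/\zeta_K(1)$ is read as $0$. -/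

import Mathlib

open Filter NumberField

namespace AlgebraicIntegerDensity

/-- `𝒪[B, 𝔼]`: the algebraic integers all of whose coordinates with respect to the integral
basis `𝔼` lie in the half-open interval `[-B, B)`. -/
def box {K : Type*} [Field K] [NumberField K]
    (E : Module.Basis (Fin (Module.finrank ℚ K)) ℤ (𝓞 K)) (B : ℝ) : Set (𝓞 K) :=
  {x | ∃ a : Fin (Module.finrank ℚ K) → ℤ,
    (∀ i, (a i : ℝ) ∈ Set.Ico (-B) B) ∧ x = ∑ i, a i • E i}

/-- The ratio `|𝒪[B, 𝔼] ^ m ∩ S| / (2 B) ^ (m k)`, where `k = [K : ℚ]`. -/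
noncomputable def boxRatio {K : Type*} [Field K] [NumberField K]
    (E : Module.Basis (Fin (Module.finrank ℚ K)) ℤ (𝓞 K)) {m : ℕ}
    (S : Set (Fin m → 𝓞 K)) (B : ℝ) : ℝ :=
  (({x : Fin m → 𝓞 K | ∀ j, x j ∈ box E B} ∩ S).ncard : ℝ) /
    (2 * B) ^ (m * Module.finrank ℚ K)

/-- The upper density of `S` with respect to the integral basis `𝔼`. -/
noncomputable def upperDensity {K : Type*} [Field K] [NumberField K]
    (E : Module.Basis (Fin (Module.finrank ℚ K)) ℤ (𝓞 K)) {m : ℕ}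
    (S : Set (Fin m → 𝓞 K)) : ℝ :=
  limsup (boxRatio E S) atTop

/-- The lower density of `S` with respect to the integral basis `𝔼`. -/
noncomputable def lowerDensity {K : Type*} [Field K] [NumberField K]
    (E : Module.Basis (Fin (Module.finrank ℚ K)) ℤ (𝓞 K)) {m : ℕ}
    (S : Set (Fin m → 𝓞 K)) : ℝ :=
  liminf (boxRatio E S) atTop

/-- `S` has density `d` with respect to the integral basis `𝔼`. -/
def HasDensityWith {K : Type*} [Field K] [NumberField K]
    (E : Module.Basis (Fin (Module.finrank ℚ K)) ℤ (𝓞 K)) {m : ℕ}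
    (S : Set (Fin m → 𝓞 K)) (d : ℝ) : Prop :=
  upperDensity E S = d ∧ lowerDensity E S = d

/-- `S` has density `d`: it has density `d` with respect to every integral basis. -/
def HasDensity {K : Type*} [Field K] [NumberField K] {m : ℕ}
    (S : Set (Fin m → 𝓞 K)) (d : ℝ) : Prop :=
  ∀ E : Module.Basis (Fin (Module.finrank ℚ K)) ℤ (𝓞 K), HasDensityWith E S d

/-- The coprime `m`-tuples of algebraic integers of `K`: those whose entries generate
the unit ideal. -/
def coprimeTuples (K : Type*) [Field K] [NumberField K] (m : ℕ) : Set (Fin m → 𝓞 K) :=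
  {x | Ideal.span (Set.range x) = ⊤}

end AlgebraicIntegerDensity

/-! Write k for the degree of K. For an ideal I ≠ 0, membership is periodic in the coordinates, so
tuples with all entries in I have density N(I)^(-m). Inclusion-exclusion over a finite set P of
primes then gives density ∏_{p ∈ P} (1 - N(p)^(-m)) to the tuples with no common prime in P
(`tendsto_boxRatio_coprimeTo`). These products tend to 1/ζ_K(m) for m ≥ 2
(`tendsto_prod_one_sub_zetaTerm`). Coprime tuples satisfy every such condition, so the upper bound
is immediate.

For the lower bound, tuples with a common prime p outside P must be few, uniformly in B. Let q be
the rational prime below p. If q ≤ 2B, the box is wide enough for lattice-point counting, and the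
loss is at most a constant times the tail of ∑ N(p)^(-m) (`boxRatio_small_residuePrime_le`). If q ≥
2B, a norm bound leaves at most k such primes for each nonzero first entry, and each of them costs a
power of B in every other entry (`exists_tendsto_zero_boxRatio_large_residuePrime_le`).

For m = 1 the upper bound suffices: the pole of ζ_K at 1 makes the finite products arbitrarily
small. -/

namespace AlgebraicIntegerDensity

open Module IsDedekindDomain
open scoped Topology

/-! ### Counting the elements of an ideal in a box -/

section Box

variable {K : Type*} [Field K] [NumberField K]

/-- `box E B` as a finset. -/
noncomputable def boxFinset (E : Basis (Fin (finrank ℚ K)) ℤ (𝓞 K)) (B : ℝ) : Finset (𝓞 K) :=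
  (Fintype.piFinset fun _ ↦ Finset.Ico ⌈-B⌉ ⌈B⌉).map E.equivFun.symm.toEquiv.toEmbedding

variable (E : Basis (Fin (finrank ℚ K)) ℤ (𝓞 K)) {B : ℝ}

theorem mem_boxFinset {x : 𝓞 K} :
    x ∈ boxFinset E B ↔ ∀ i, E.repr x i ∈ Finset.Ico ⌈-B⌉ ⌈B⌉ := by
  simp only [boxFinset, Finset.mem_map_equiv, Fintype.mem_piFinset]
  rfl

theorem mem_box_iff {x : 𝓞 K} : x ∈ box E B ↔ x ∈ boxFinset E B := by
  simp only [mem_boxFinset, box, Set.mem_ofPred_eq, Finset.mem_Ico, Set.mem_Ico, Int.ceil_le,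
    Int.lt_ceil]
  constructor
  · rintro ⟨a, ha, rfl⟩ i
    rw [E.repr_sum_self]
    exact ha i
  · intro h
    exact ⟨fun i ↦ E.repr x i, h, (E.sum_repr x).symm⟩

/-- The count is a difference of two ceilings, off by less than 1 from the length over n. Rounding
the endpoints ±B costs at most 1 more, as n ≥ 1. -/
theorem abs_card_filter_Ico_sub_le (hB : 0 ≤ B) {n : ℕ} (hn : 0 < n) (v : ZMod n) :
    |(({a ∈ Finset.Ico ⌈-B⌉ ⌈B⌉ | ((a : ℤ) : ZMod n) = v}).card : ℝ) - 2 * B / n| ≤ 2 := by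
  obtain ⟨v, rfl⟩ := ZMod.intCast_surjective v
  have hn' : (1 : ℝ) ≤ n := by exact_mod_cast hn
  have key := Int.Ico_filter_modEq_card ⌈-B⌉ ⌈B⌉ (r := (n : ℤ)) (by exact_mod_cast hn) v
  simp_rw [ZMod.intCast_eq_intCast_iff]
  have h1 := Int.le_ceil B
  have h2 := Int.ceil_lt_add_one B
  have h3 := Int.le_ceil (-B)
  have h4 := Int.ceil_lt_add_one (-B)
  set b := ⌈B⌉
  set a := ⌈-B⌉
  set c := Finset.card {x ∈ Finset.Ico a b | x ≡ v [ZMOD n]}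
  have key' : (c : ℤ) = ⌈((b : ℝ) - v) / n⌉ - ⌈((a : ℝ) - v) / n⌉ := by
    rw [key]
    have e (z : ℤ) : ⌈((z : ℝ) - v) / n⌉ = ⌈((z : ℚ) - v) / (n : ℤ)⌉ := by
      rw [← Rat.ceil_cast (α := ℝ)]
      push_cast
      rfl
    rw [e, e, max_eq_left]
    have hab : a ≤ b := Int.ceil_mono (by linarith)
    have hn0 : (0 : ℚ) ≤ (n : ℤ) := by positivity
    have hab' : (a : ℚ) ≤ b := by exact_mod_cast hab
    have : ⌈((a : ℚ) - v) / (n : ℤ)⌉ ≤ ⌈((b : ℚ) - v) / (n : ℤ)⌉ := by gcongr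
    linarith
  have key'' : (c : ℝ) = ⌈((b : ℝ) - v) / n⌉ - ⌈((a : ℝ) - v) / n⌉ := by exact_mod_cast key'
  have h5 := Int.le_ceil (((b : ℝ) - v) / n)
  have h6 := Int.ceil_lt_add_one (((b : ℝ) - v) / n)
  have h7 := Int.le_ceil (((a : ℝ) - v) / n)
  have h8 := Int.ceil_lt_add_one (((a : ℝ) - v) / n)
  have h9 : ((b : ℝ) - v) / n - ((a : ℝ) - v) / n - 2 * B / n = (b - a - 2 * B) / n := by ring
  have h10 : |(b - a - 2 * B) / (n : ℝ)| ≤ 1 := by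
    rw [abs_div, abs_of_pos (by linarith : (0 : ℝ) < n), div_le_one (by linarith)]
    exact (abs_le.2 ⟨by linarith, by linarith⟩ : _ ≤ (1 : ℝ)).trans hn'
  rw [abs_le] at h10 ⊢
  constructor <;> linarith

theorem card_Ico_ceil_le (hB : 0 ≤ B) : ((Finset.Ico ⌈-B⌉ ⌈B⌉).card : ℝ) ≤ 2 * B + 1 := by
  rw [Int.card_Ico]
  have hab : (0 : ℤ) ≤ ⌈B⌉ - ⌈-B⌉ := sub_nonneg.2 (Int.ceil_mono (by linarith))
  have : (((⌈B⌉ - ⌈-B⌉).toNat : ℤ) : ℝ) = ⌈B⌉ - ⌈-B⌉ := by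
    rw [Int.toNat_of_nonneg hab]; push_cast; rfl
  rw [Int.cast_natCast] at this
  rw [this]
  linarith [Int.ceil_lt_add_one B, Int.le_ceil (-B)]

theorem card_boxFinset_le (hB : 0 ≤ B) :
    ((boxFinset E B).card : ℝ) ≤ (2 * B + 1) ^ finrank ℚ K := by
  rw [boxFinset, Finset.card_map, Fintype.card_piFinset_const, Nat.cast_pow]
  gcongr
  exact card_Ico_ceil_le hB

/-- The coordinates with respect to `E`, reduced modulo `n`. -/
noncomputable def coordMod (n : ℕ) : 𝓞 K →+ (Fin (finrank ℚ K) → ZMod n) :=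
  ((Int.castAddHom (ZMod n)).compLeft _).comp E.equivFun.toLinearMap.toAddMonoidHom

theorem coordMod_apply (n : ℕ) (x : 𝓞 K) (i) : coordMod E n x i = (E.repr x i : ZMod n) := rfl

theorem coordMod_surjective (n : ℕ) : Function.Surjective (coordMod E n) := by
  intro r
  choose a ha using fun i ↦ ZMod.intCast_surjective (r i)
  refine ⟨E.equivFun.symm a, funext fun i ↦ ?_⟩
  rw [coordMod_apply, ← E.equivFun_apply, LinearEquiv.apply_symm_apply, ha]

/-- Since n lies in I, so does n𝓞. Membership in I thus depends only on coordinates mod n, and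
counting in I becomes counting residue vectors. -/
theorem ker_coordMod_le {I : Ideal (𝓞 K)} {n : ℕ} (hn : (n : 𝓞 K) ∈ I) :
    (coordMod E n).ker ≤ I.toAddSubgroup := by
  intro x hx
  rw [AddMonoidHom.mem_ker] at hx
  change x ∈ I
  rw [← E.sum_repr x]
  refine I.sum_mem fun i _ ↦ ?_
  have := congrFun hx i
  rw [coordMod_apply, Pi.zero_apply, ZMod.intCast_zmod_eq_zero_iff_dvd] at this
  obtain ⟨c, hc⟩ := this
  rw [hc, zsmul_eq_mul]
  push_cast
  rw [mul_assoc]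
  exact I.mul_mem_right _ hn

theorem card_map_coordMod_mul_absNorm {I : Ideal (𝓞 K)} {n : ℕ} (hn : (n : 𝓞 K) ∈ I) :
    Nat.card (I.toAddSubgroup.map (coordMod E n)) * Ideal.absNorm I = n ^ finrank ℚ K := by
  rw [Ideal.absNorm_eq_index,
    ← AddSubgroup.index_map_eq _ (coordMod_surjective E n) (ker_coordMod_le E hn),
    AddSubgroup.card_mul_index, Nat.card_fun, Nat.card_zmod, Nat.card_eq_fintype_card,
    Fintype.card_fin]

open scoped Classical in
/-- The elements of an ideal that lie in the box. -/
noncomputable def boxIdeal (I : Ideal (𝓞 K)) (B : ℝ) : Finset (𝓞 K) :=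
  {x ∈ boxFinset E B | x ∈ I}

theorem mem_boxIdeal {I : Ideal (𝓞 K)} {x : 𝓞 K} :
    x ∈ boxIdeal E I B ↔ x ∈ boxFinset E B ∧ x ∈ I := by
  simp [boxIdeal]

open scoped Classical in
theorem card_filter_coordMod_eq {n : ℕ} (r : Fin (finrank ℚ K) → ZMod n) :
    ({x ∈ boxFinset E B | coordMod E n x = r}).card =
      ∏ i, ({a ∈ Finset.Ico ⌈-B⌉ ⌈B⌉ | ((a : ℤ) : ZMod n) = r i}).card := by
  rw [← Fintype.card_piFinset, ← Finset.card_map E.equivFun.symm.toEquiv.toEmbedding]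
  congr 1
  ext x
  simp only [Finset.mem_filter, mem_boxFinset, Finset.mem_map_equiv, Fintype.mem_piFinset,
    funext_iff, coordMod_apply, ← forall_and]
  rfl

open scoped Classical in
theorem card_boxIdeal_eq {I : Ideal (𝓞 K)} {n : ℕ} [NeZero n] (hn : (n : 𝓞 K) ∈ I) :
    (boxIdeal E I B).card = ∑ r with r ∈ I.toAddSubgroup.map (coordMod E n),
      ∏ i, ({a ∈ Finset.Ico ⌈-B⌉ ⌈B⌉ | ((a : ℤ) : ZMod n) = r i}).card := by
  rw [Finset.card_eq_sum_card_fiberwise (f := coordMod E n)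
    (t := {r | r ∈ I.toAddSubgroup.map (coordMod E n)})]
  · refine Finset.sum_congr rfl fun r hr ↦ ?_
    rw [← card_filter_coordMod_eq, boxIdeal, Finset.filter_filter]
    congr 1
    refine Finset.filter_congr fun x _ ↦ and_iff_right_of_imp fun hx ↦ ?_
    obtain ⟨y, hy, rfl⟩ := (Finset.mem_filter.1 hr).2
    have : x - y ∈ (coordMod E n).ker := by
      rw [AddMonoidHom.mem_ker, map_sub, hx, sub_self]
    simpa using I.add_mem (ker_coordMod_le E hn this) hy
  · intro x hx
    simp only [Finset.coe_filter, Finset.mem_univ, true_and, Set.mem_ofPred_eq]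
    exact AddSubgroup.mem_map_of_mem _ (mem_boxIdeal E |>.1 hx).2

open scoped Classical in
theorem card_filter_map_coordMod {I : Ideal (𝓞 K)} (hI : I ≠ ⊥) {n : ℕ} [NeZero n]
    (hn : (n : 𝓞 K) ∈ I) :
    (({r | r ∈ I.toAddSubgroup.map (coordMod E n)} : Finset _).card : ℝ) =
      (n : ℝ) ^ finrank ℚ K / Ideal.absNorm I := by
  have hN : (Ideal.absNorm I : ℝ) ≠ 0 := by
    simpa [Ideal.absNorm_eq_zero_iff] using hI
  rw [eq_div_iff hN]
  have := card_map_coordMod_mul_absNorm E hn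
  rw [← Nat.cast_pow, ← this, Nat.cast_mul]
  congr 2
  exact (Nat.subtype_card _ fun x ↦ by rw [Finset.mem_filter_univ]).symm

/-- There are n^k / N(I) admissible residue vectors, each hit at most (2B/n + 2)^k times. The
explicit dependence on n is what makes the bound uniform over primes in the tail estimate. -/
theorem card_boxIdeal_le {I : Ideal (𝓞 K)} (hI : I ≠ ⊥) {n : ℕ} (hn0 : 0 < n)
    (hn : (n : 𝓞 K) ∈ I) (hB : 0 ≤ B) :
    ((boxIdeal E I B).card : ℝ) ≤ (2 * B + 2 * n) ^ finrank ℚ K / Ideal.absNorm I := by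
  classical
  have : NeZero n := ⟨hn0.ne'⟩
  have hn0' : (n : ℝ) ≠ 0 := by positivity
  rw [card_boxIdeal_eq E hn]
  push_cast
  refine (Finset.sum_le_card_nsmul _ _ ((2 * B / n + 2) ^ finrank ℚ K) fun r _ ↦ ?_).trans ?_
  · refine (Finset.prod_le_prod (fun _ _ ↦ by positivity) (g := fun _ ↦ 2 * B / n + 2)
      fun i _ ↦ ?_).trans (by simp)
    linarith [(abs_le.1 (abs_card_filter_Ico_sub_le hB hn0 (r i))).2]
  · rw [nsmul_eq_mul, card_filter_map_coordMod E hI hn, div_mul_eq_mul_div, ← mul_pow, mul_add,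
      mul_div_cancel₀ _ hn0', mul_comm (n : ℝ) 2]

theorem le_card_boxIdeal {I : Ideal (𝓞 K)} (hI : I ≠ ⊥) {n : ℕ} (hn0 : 0 < n)
    (hn : (n : 𝓞 K) ∈ I) (hB : (n : ℝ) ≤ B) :
    (2 * B - 2 * n) ^ finrank ℚ K / Ideal.absNorm I ≤ ((boxIdeal E I B).card : ℝ) := by
  classical
  have : NeZero n := ⟨hn0.ne'⟩
  have hn0' : (n : ℝ) ≠ 0 := by positivity
  have hnB : 0 ≤ 2 * B / n - 2 := by
    rw [sub_nonneg, le_div_iff₀ (by positivity)]; linarith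
  rw [card_boxIdeal_eq E hn]
  push_cast
  refine le_trans ?_ (Finset.card_nsmul_le_sum _ _ ((2 * B / n - 2) ^ finrank ℚ K) fun r _ ↦ ?_)
  · rw [nsmul_eq_mul, card_filter_map_coordMod E hI hn, div_mul_eq_mul_div, ← mul_pow, mul_sub,
      mul_div_cancel₀ _ hn0', mul_comm (n : ℝ) 2]
  · refine le_trans (by simp) (Finset.prod_le_prod (f := fun _ ↦ 2 * B / n - 2) (fun _ _ ↦ hnB)
      fun i _ ↦ ?_)
    linarith [(abs_le.1 (abs_card_filter_Ico_sub_le ((Nat.cast_nonneg n).trans hB) hn0 (r i))).1]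

theorem tendsto_card_boxIdeal_div {I : Ideal (𝓞 K)} (hI : I ≠ ⊥) :
    Tendsto (fun B : ℝ ↦ ((boxIdeal E I B).card : ℝ) / (2 * B) ^ finrank ℚ K) atTop
      (𝓝 (Ideal.absNorm I : ℝ)⁻¹) := by
  set n := Ideal.absNorm I
  have hn0 : 0 < n := Nat.pos_of_ne_zero (by simpa [n, Ideal.absNorm_eq_zero_iff] using hI)
  have hn := Ideal.absNorm_mem I
  have h0 : Tendsto (fun B : ℝ ↦ (n : ℝ) / B) atTop (𝓝 0) := tendsto_const_nhds.div_atTop tendsto_id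
  have hl : Tendsto (fun B : ℝ ↦ (1 - n / B) ^ finrank ℚ K / n) atTop (𝓝 (n : ℝ)⁻¹) := by
    simpa using ((tendsto_const_nhds (x := (1 : ℝ)).sub h0).pow (finrank ℚ K)).div_const (n : ℝ)
  have hu : Tendsto (fun B : ℝ ↦ (1 + n / B) ^ finrank ℚ K / n) atTop (𝓝 (n : ℝ)⁻¹) := by
    simpa using ((tendsto_const_nhds (x := (1 : ℝ)).add h0).pow (finrank ℚ K)).div_const (n : ℝ)
  refine tendsto_of_tendsto_of_tendsto_of_le_of_le' hl hu ?_ ?_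
  · filter_upwards [eventually_ge_atTop (n : ℝ), eventually_gt_atTop 0] with B hB hB0
    rw [le_div_iff₀ (by positivity), div_mul_eq_mul_div, ← mul_pow]
    rw [show (1 - n / B) * (2 * B) = 2 * B - 2 * n by field_simp]
    exact le_card_boxIdeal E hI hn0 hn hB
  · filter_upwards [eventually_gt_atTop 0] with B hB0
    rw [div_le_iff₀ (by positivity), div_mul_eq_mul_div, ← mul_pow]
    rw [show (1 + n / B) * (2 * B) = 2 * B + 2 * n by field_simp]
    exact card_boxIdeal_le E hI hn0 hn hB0.le

end Box

/-! ### Tuples avoiding finitely many primes -/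

section Tuples

variable {K : Type*} [Field K] [NumberField K] (E : Basis (Fin (finrank ℚ K)) ℤ (𝓞 K)) {B : ℝ}
  {m : ℕ}

/-- The `m`-tuples of elements of the box. -/
noncomputable def boxTuples (m : ℕ) (B : ℝ) : Finset (Fin m → 𝓞 K) :=
  Fintype.piFinset fun _ ↦ boxFinset E B

theorem mem_boxTuples {x : Fin m → 𝓞 K} : x ∈ boxTuples E m B ↔ ∀ j, x j ∈ boxFinset E B :=
  Fintype.mem_piFinset

open scoped Classical in
theorem boxRatio_eq (S : Set (Fin m → 𝓞 K)) :
    boxRatio E S B = (({x ∈ boxTuples E m B | x ∈ S}).card : ℝ) /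
      (2 * B) ^ (m * finrank ℚ K) := by
  rw [boxRatio, ← Set.ncard_coe_finset]
  congr 3
  ext x
  simp [mem_boxTuples, mem_box_iff]

theorem boxRatio_le_card_div {S : Set (Fin m → 𝓞 K)} (T : Finset (Fin m → 𝓞 K))
    (h : ∀ x ∈ boxTuples E m B, x ∈ S → x ∈ T) (hB : 0 ≤ B) :
    boxRatio E S B ≤ T.card / (2 * B) ^ (m * finrank ℚ K) := by
  classical
  rw [boxRatio_eq]
  gcongr
  intro x hx
  exact h x (Finset.mem_filter.1 hx).1 (Finset.mem_filter.1 hx).2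

theorem boxRatio_nonneg (S : Set (Fin m → 𝓞 K)) (hB : 0 ≤ B) : 0 ≤ boxRatio E S B := by
  unfold boxRatio
  positivity

theorem boxRatio_mono {S T : Set (Fin m → 𝓞 K)} (h : S ⊆ T) (hB : 0 ≤ B) :
    boxRatio E S B ≤ boxRatio E T B := by
  classical
  rw [boxRatio_eq, boxRatio_eq]
  gcongr

theorem boxRatio_union_le (S T : Set (Fin m → 𝓞 K)) (hB : 0 ≤ B) :
    boxRatio E (S ∪ T) B ≤ boxRatio E S B + boxRatio E T B := by
  classical
  rw [boxRatio_eq, boxRatio_eq, boxRatio_eq, ← add_div]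
  gcongr
  simp only [Set.mem_union, Finset.filter_or]
  exact_mod_cast Finset.card_union_le _ _

open scoped Classical in
theorem filter_boxTuples_forall_mem (I : Ideal (𝓞 K)) :
    {x ∈ boxTuples E m B | ∀ j, x j ∈ I} = Fintype.piFinset fun _ ↦ boxIdeal E I B := by
  ext x
  simp [mem_boxTuples, mem_boxIdeal, forall_and]

theorem tendsto_boxRatio_forall_mem {I : Ideal (𝓞 K)} (hI : I ≠ ⊥) :
    Tendsto (boxRatio E {x : Fin m → 𝓞 K | ∀ j, x j ∈ I}) atTop
      (𝓝 ((Ideal.absNorm I : ℝ) ^ m)⁻¹) := by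
  classical
  rw [← inv_pow]
  refine ((tendsto_card_boxIdeal_div E hI).pow m).congr fun B ↦ ?_
  rw [boxRatio_eq, div_pow, ← pow_mul, mul_comm m]
  simp only [Set.mem_ofPred_eq, filter_boxTuples_forall_mem, Fintype.card_piFinset_const,
    Nat.cast_pow]

theorem mem_prod_asIdeal_iff (P : Finset (HeightOneSpectrum (𝓞 K))) (x : 𝓞 K) :
    x ∈ ∏ p ∈ P, p.asIdeal ↔ ∀ p ∈ P, x ∈ p.asIdeal := by
  classical
  simp_rw [← Ideal.dvd_span_singleton]
  constructor
  · exact fun h p hp ↦ (Finset.dvd_prod_of_mem _ hp).trans h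
  · intro h
    have hinj : Set.InjOn (fun p : HeightOneSpectrum (𝓞 K) ↦ p.asIdeal) P :=
      fun p _ q _ hpq ↦ HeightOneSpectrum.ext hpq
    have := Finset.prod_primes_dvd (s := P.image fun p ↦ p.asIdeal) (Ideal.span {x})
      (by simpa using fun p _ ↦ p.prime) (by simpa using h)
    rwa [Finset.prod_image hinj] at this

/-- The tuples whose entries are not all divisible by the same prime of `P`. -/
def coprimeTo (P : Finset (HeightOneSpectrum (𝓞 K))) (m : ℕ) : Set (Fin m → 𝓞 K) :=
  {x | ∀ p ∈ P, ¬ ∀ j, x j ∈ p.asIdeal}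

/-- Inclusion-exclusion, exact for every B: expand the indicator as ∏ (1 - 1_p). Lying in all primes
of Q is lying in their product. -/
theorem boxRatio_coprimeTo_eq (P : Finset (HeightOneSpectrum (𝓞 K))) :
    boxRatio E (coprimeTo P m) B = ∑ Q ∈ P.powerset, (-1 : ℝ) ^ Q.card *
      boxRatio E {x : Fin m → 𝓞 K | ∀ j, x j ∈ ∏ p ∈ Q, p.asIdeal} B := by
  classical
  simp only [boxRatio_eq, ← mul_div_assoc, ← Finset.sum_div]
  congr 1
  simp only [Finset.card_filter, Nat.cast_sum, Finset.mul_sum, Nat.cast_ite, Nat.cast_one,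
    Nat.cast_zero]
  rw [Finset.sum_comm]
  refine Finset.sum_congr rfl fun x _ ↦ ?_
  have h1 : (if x ∈ coprimeTo P m then (1 : ℝ) else 0) =
      ∏ p ∈ P, (1 - if ∀ j, x j ∈ p.asIdeal then (1 : ℝ) else 0) := by
    split_ifs with h
    · exact (Finset.prod_eq_one fun p hp ↦ by simp [h p hp]).symm
    · rw [coprimeTo, Set.mem_ofPred_eq] at h
      push Not at h
      obtain ⟨p, hp, h⟩ := h
      exact (Finset.prod_eq_zero hp (by rw [if_pos h, sub_self])).symm
  rw [h1, Finset.prod_sub]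
  refine Finset.sum_congr rfl fun Q _ ↦ ?_
  rw [Finset.prod_const_one, mul_one, Finset.prod_ite_zero, Finset.prod_const_one]
  simp only [Set.mem_ofPred_eq, mem_prod_asIdeal_iff]
  congr 1
  refine if_congr ⟨fun h j p hp ↦ h p hp j, fun h p hp j ↦ h j p hp⟩ rfl rfl

theorem tendsto_boxRatio_coprimeTo (P : Finset (HeightOneSpectrum (𝓞 K))) :
    Tendsto (boxRatio E (coprimeTo P m)) atTop
      (𝓝 (∏ p ∈ P, (1 - ((Ideal.absNorm p.asIdeal : ℝ) ^ m)⁻¹))) := by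
  classical
  rw [Finset.prod_sub]
  simp only [Finset.prod_const_one, mul_one]
  refine (tendsto_finsetSum P.powerset fun Q _ ↦ (tendsto_boxRatio_forall_mem E (m := m)
    (I := ∏ p ∈ Q, p.asIdeal) (Finset.prod_ne_zero_iff.2 fun p _ ↦ p.ne_bot)).const_mul
      ((-1 : ℝ) ^ Q.card)).congr' ?_ |>.trans_eq ?_
  · exact Eventually.of_forall fun B ↦ (boxRatio_coprimeTo_eq E P).symm
  · simp [map_prod, Finset.prod_pow]

theorem mem_coprimeTuples_iff {x : Fin m → 𝓞 K} :
    x ∈ coprimeTuples K m ↔ ∀ p : HeightOneSpectrum (𝓞 K), ¬ ∀ j, x j ∈ p.asIdeal := by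
  have hle (I : Ideal (𝓞 K)) : Ideal.span (Set.range x) ≤ I ↔ ∀ j, x j ∈ I := by
    rw [Ideal.span_le, Set.range_subset_iff]
    rfl
  rw [coprimeTuples, Set.mem_ofPred_eq]
  constructor
  · intro h p hp
    rw [← hle, h, top_le_iff] at hp
    exact p.isPrime.ne_top hp
  · intro h
    by_contra hne
    obtain ⟨M, hM, hle'⟩ := Ideal.exists_le_maximal _ hne
    exact h ⟨M, hM.isPrime, Ring.ne_bot_of_isMaximal_of_not_isField hM
      (RingOfIntegers.not_isField K)⟩ ((hle M).1 hle')

theorem coprimeTuples_subset (P : Finset (HeightOneSpectrum (𝓞 K))) :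
    coprimeTuples K m ⊆ coprimeTo P m :=
  fun _ hx p _ ↦ mem_coprimeTuples_iff.1 hx p

end Tuples

/-! ### The Dedekind zeta function and its Euler product at real points -/

section Zeta

variable (K : Type*) [Field K] [NumberField K]

/-- The number of ideals of norm at most n grows linearly, so the partial sums of the coefficients
are O(n). -/
theorem lseriesSummable_card_absNorm_eq {s : ℝ} (hs : 1 < s) :
    LSeriesSummable (fun n ↦ (Nat.card {I : Ideal (𝓞 K) // Ideal.absNorm I = n} : ℂ)) s := by
  have h := (NumberField.Ideal.tendsto_norm_le_div_atTop K).comp tendsto_natCast_atTop_atTop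
  refine LSeriesSummable_of_sum_norm_bigO_and_nonneg (r := 1)
    (f := fun n ↦ (Nat.card {I : Ideal (𝓞 K) // Ideal.absNorm I = n} : ℝ)) ?_
    (fun n ↦ Nat.cast_nonneg _) zero_le_one (by simpa using hs)
  have h1 : (fun n : ℕ ↦ (Nat.card {I : Ideal (𝓞 K) // (Ideal.absNorm I : ℝ) ≤ (n : ℝ)} : ℝ))
      =O[atTop] fun n ↦ (n : ℝ) ^ (1 : ℝ) :=
    Asymptotics.isBigO_atTop_natCast_rpow_of_tendsto_div_rpow (by
      simp only [Real.rpow_one]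
      exact h)
  refine (Asymptotics.isBigO_of_le _ fun n ↦ ?_).trans h1
  rw [Real.norm_of_nonneg (by positivity), Real.norm_of_nonneg (by positivity), ← Nat.cast_sum,
    Nat.cast_le]
  have hfin : {I : Ideal (𝓞 K) | Ideal.absNorm I ≤ n}.Finite := Ideal.finite_setOfPred_absNorm_le n
  have := Finset.card_preimage_eq_sum_card_image_eq (f := fun I : Ideal (𝓞 K) ↦ Ideal.absNorm I)
    (s := Finset.Icc 1 n) (fun k _ ↦ Ideal.finite_setOfPred_absNorm_eq k)
  refine this.symm.trans_le ?_
  simp only [Nat.cast_le]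
  refine Nat.card_mono (t := {I : Ideal (𝓞 K) | Ideal.absNorm I ≤ n}) hfin fun I hI ↦ ?_
  exact (Finset.mem_Icc.1 (Set.mem_preimage.1 hI)).2

/-- The term of the Dedekind zeta function at `s` that belongs to an ideal. -/
noncomputable def zetaTerm (s : ℝ) (I : Ideal (𝓞 K)) : ℝ := (Ideal.absNorm I : ℝ) ^ (-s)

variable {K}

theorem zetaTerm_nonneg (s : ℝ) (I : Ideal (𝓞 K)) : 0 ≤ zetaTerm K s I := by
  unfold zetaTerm; positivity

theorem zetaTerm_mul (s : ℝ) (I J : Ideal (𝓞 K)) :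
    zetaTerm K s (I * J) = zetaTerm K s I * zetaTerm K s J := by
  rw [zetaTerm, map_mul, Nat.cast_mul, Real.mul_rpow (by positivity) (by positivity)]
  rfl

theorem zetaTerm_natCast (m : ℕ) (I : Ideal (𝓞 K)) :
    zetaTerm K m I = ((Ideal.absNorm I : ℝ) ^ m)⁻¹ := by
  rw [zetaTerm, Real.rpow_neg (by positivity), Real.rpow_natCast]

theorem zetaTerm_top (s : ℝ) : zetaTerm K s ⊤ = 1 := by
  rw [zetaTerm, Ideal.absNorm_top, Nat.cast_one, Real.one_rpow]

theorem one_lt_absNorm (p : HeightOneSpectrum (𝓞 K)) : 1 < Ideal.absNorm p.asIdeal := by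
  have h0 : Ideal.absNorm p.asIdeal ≠ 0 := by simpa [Ideal.absNorm_eq_zero_iff] using p.ne_bot
  have h1 : Ideal.absNorm p.asIdeal ≠ 1 := by
    simpa [Ideal.absNorm_eq_one_iff] using p.isPrime.ne_top
  omega

theorem zetaTerm_lt_one {s : ℝ} (hs : 0 < s) (p : HeightOneSpectrum (𝓞 K)) :
    zetaTerm K s p.asIdeal < 1 :=
  Real.rpow_lt_one_of_one_lt_of_neg (by exact_mod_cast one_lt_absNorm p) (by linarith)

theorem hasSum_zetaTerm_fiber {s : ℝ} (n : ℕ) :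
    HasSum (fun I : {I : Ideal (𝓞 K) // Ideal.absNorm I = n} ↦ zetaTerm K s I)
      (Nat.card {I : Ideal (𝓞 K) // Ideal.absNorm I = n} * (n : ℝ) ^ (-s)) := by
  have : Fintype {I : Ideal (𝓞 K) // Ideal.absNorm I = n} :=
    (Ideal.finite_setOfPred_absNorm_eq n).fintype
  convert hasSum_fintype (fun I : {I : Ideal (𝓞 K) // Ideal.absNorm I = n} ↦ zetaTerm K s I)
  rw [Finset.sum_congr rfl (g := fun _ ↦ (n : ℝ) ^ (-s)) fun I _ ↦ by rw [zetaTerm, I.2],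
    Finset.sum_const, Finset.card_univ, nsmul_eq_mul, Nat.card_eq_fintype_card]

theorem term_card_absNorm_eq {s : ℝ} (hs : s ≠ 0) (n : ℕ) :
    LSeries.term (fun n ↦ (Nat.card {I : Ideal (𝓞 K) // Ideal.absNorm I = n} : ℂ)) s n =
      ((Nat.card {I : Ideal (𝓞 K) // Ideal.absNorm I = n} * (n : ℝ) ^ (-s) : ℝ) : ℂ) := by
  rcases eq_or_ne n 0 with rfl | hn
  -- The zero ideal has norm 0 and contributes nothing: the L-series term at 0 is 0 by convention,
  -- and 0 ^ (-s) = 0 because s ≠ 0.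
  · simp [hs]
  · rw [LSeries.term_of_ne_zero hn, Real.rpow_neg (by positivity), div_eq_mul_inv]
    push_cast [Complex.ofReal_cpow (Nat.cast_nonneg n)]
    rfl

theorem summable_zetaTerm {s : ℝ} (hs : 1 < s) : Summable (zetaTerm K s) := by
  rw [← (Equiv.sigmaFiberEquiv fun I : Ideal (𝓞 K) ↦ Ideal.absNorm I).summable_iff]
  refine (summable_sigma_of_nonneg fun _ ↦ zetaTerm_nonneg _ _).2 ?_
  refine ⟨fun n ↦ (hasSum_zetaTerm_fiber n).summable, ?_⟩
  have h := lseriesSummable_card_absNorm_eq K hs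
  rw [LSeriesSummable, funext (term_card_absNorm_eq (by linarith)), Complex.summable_ofReal] at h
  exact h.congr fun n ↦ (hasSum_zetaTerm_fiber n).tsum_eq.symm

theorem tsum_zetaTerm {s : ℝ} (hs : 1 < s) :
    ((∑' I, zetaTerm K s I : ℝ) : ℂ) = dedekindZeta K s := by
  have h := ((Equiv.sigmaFiberEquiv fun I : Ideal (𝓞 K) ↦ Ideal.absNorm I).hasSum_iff.2
    (summable_zetaTerm (K := K) hs).hasSum).sigma fun n ↦ hasSum_zetaTerm_fiber n
  rw [dedekindZeta, LSeries, funext (term_card_absNorm_eq (by linarith))]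
  exact (Complex.hasSum_ofReal.2 h).tsum_eq.symm

/-- The ideals that no prime of `P` divides. -/
def idealsCoprimeTo (P : Finset (HeightOneSpectrum (𝓞 K))) : Set (Ideal (𝓞 K)) :=
  {I | ∀ p ∈ P, ¬ p.asIdeal ∣ I}

/-- Sieve of Eratosthenes: for p outside P, multiplication by p maps the ideals coprime to P onto
those that are also divisible by p, so the factor 1 - N(p)^(-s) removes exactly these. -/
theorem prod_one_sub_zetaTerm_mul_tsum {s : ℝ} (hs : 1 < s)
    (P : Finset (HeightOneSpectrum (𝓞 K))) :
    (∏ p ∈ P, (1 - zetaTerm K s p.asIdeal)) * ∑' I, zetaTerm K s I =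
      ∑' I, (idealsCoprimeTo P).indicator (zetaTerm K s) I := by
  classical
  induction P using Finset.induction_on with
  | empty => simp [idealsCoprimeTo]
  | insert p P hp ih =>
    rw [Finset.prod_insert hp, mul_assoc, ih, sub_mul, one_mul, sub_eq_iff_eq_add,
      ← tsum_mul_left]
    have hinj : Function.Injective fun I : Ideal (𝓞 K) ↦ p.asIdeal * I :=
      fun I J h ↦ mul_left_cancel₀ p.ne_bot h
    have h1 (I : Ideal (𝓞 K)) : zetaTerm K s p.asIdeal *
        (idealsCoprimeTo P).indicator (zetaTerm K s) I =
        ({J | p.asIdeal ∣ J} ∩ idealsCoprimeTo P).indicator (zetaTerm K s) (p.asIdeal * I) := by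
      have : p.asIdeal * I ∈ {J | p.asIdeal ∣ J} ∩ idealsCoprimeTo P ↔ I ∈ idealsCoprimeTo P := by
        simp only [Set.mem_inter_iff, Set.mem_ofPred_eq, dvd_mul_right, true_and, idealsCoprimeTo]
        refine forall₂_congr fun q hq ↦ not_congr ?_
        rw [q.prime.dvd_mul, or_iff_right]
        intro h
        have : q.asIdeal = p.asIdeal :=
          (p.isMaximal.eq_of_le q.isPrime.ne_top (Ideal.le_of_dvd h)).symm
        exact hp (HeightOneSpectrum.ext this ▸ hq)
      by_cases hI : I ∈ idealsCoprimeTo P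
      · rw [Set.indicator_of_mem hI, Set.indicator_of_mem (this.2 hI), zetaTerm_mul]
      · rw [Set.indicator_of_notMem hI, Set.indicator_of_notMem (mt this.1 hI), mul_zero]
    rw [tsum_congr h1, hinj.tsum_eq
      (f := ({J | p.asIdeal ∣ J} ∩ idealsCoprimeTo P).indicator (zetaTerm K s)),
      ← ((summable_zetaTerm hs).indicator _).tsum_add ((summable_zetaTerm hs).indicator _)]
    · refine tsum_congr fun I ↦ ?_
      have : I ∈ idealsCoprimeTo (insert p P) ↔ ¬ p.asIdeal ∣ I ∧ I ∈ idealsCoprimeTo P := by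
        simp [idealsCoprimeTo]
      simp only [Set.indicator_apply, this, Set.mem_inter_iff, Set.mem_ofPred_eq]
      by_cases hpI : p.asIdeal ∣ I <;> simp [hpI]
    · intro J hJ
      obtain ⟨I, hI⟩ := (Set.mem_of_indicator_ne_zero hJ).1
      exact ⟨I, hI.symm⟩

/-- Every proper ideal is eventually sieved out by a maximal ideal above it; only the unit ideal
survives, and dominated convergence applies. -/
theorem tendsto_prod_one_sub_zetaTerm_mul_tsum {s : ℝ} (hs : 1 < s) :
    Tendsto (fun P : Finset (HeightOneSpectrum (𝓞 K)) ↦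
      (∏ p ∈ P, (1 - zetaTerm K s p.asIdeal)) * ∑' I, zetaTerm K s I) atTop (𝓝 1) := by
  classical
  simp_rw [prod_one_sub_zetaTerm_mul_tsum hs]
  have h : ∑' I, ({⊤} : Set (Ideal (𝓞 K))).indicator (zetaTerm K s) I = 1 := by
    rw [tsum_eq_single ⊤ fun I hI ↦ by simp [hI]]
    simp [zetaTerm_top]
  rw [← h]
  refine tendsto_tsum_of_dominated_convergence (bound := zetaTerm K s) (summable_zetaTerm hs)
    (fun I ↦ ?_) (Eventually.of_forall fun P I ↦ ?_)
  · rcases eq_or_ne I ⊤ with rfl | hI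
    · refine tendsto_const_nhds.congr fun P ↦ ?_
      rw [Set.indicator_of_mem (Set.mem_singleton _), Set.indicator_of_mem]
      intro p _ hp
      rw [← Ideal.one_eq_top] at hp
      exact p.prime.not_isUnit (isUnit_of_dvd_one hp)
    · obtain ⟨M, hM, hIM⟩ := Ideal.exists_le_maximal I hI
      let p : HeightOneSpectrum (𝓞 K) := ⟨M, hM.isPrime, Ring.ne_bot_of_isMaximal_of_not_isField hM
        (RingOfIntegers.not_isField K)⟩
      refine tendsto_const_nhds.congr' ?_
      filter_upwards [eventually_ge_atTop {p}] with P hP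
      rw [Set.indicator_of_notMem (by simpa using hI), Set.indicator_of_notMem]
      intro h
      exact h p (hP (Finset.mem_singleton_self p)) (Ideal.dvd_iff_le.2 hIM)
  · rw [Real.norm_of_nonneg (Set.indicator_nonneg (fun _ _ ↦ zetaTerm_nonneg _ _) _)]
    exact Set.indicator_le_self' (fun _ _ ↦ zetaTerm_nonneg _ _) _

theorem one_le_tsum_zetaTerm {s : ℝ} (hs : 1 < s) : 1 ≤ ∑' I, zetaTerm K s I := by
  rw [← zetaTerm_top (K := K) s]
  exact (summable_zetaTerm hs).le_tsum _ fun _ _ ↦ zetaTerm_nonneg _ _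

theorem tendsto_prod_one_sub_zetaTerm {s : ℝ} (hs : 1 < s) :
    Tendsto (fun P : Finset (HeightOneSpectrum (𝓞 K)) ↦
      ∏ p ∈ P, (1 - zetaTerm K s p.asIdeal)) atTop (𝓝 (∑' I, zetaTerm K s I)⁻¹) := by
  have h0 : ∑' I, zetaTerm K s I ≠ 0 := by linarith [one_le_tsum_zetaTerm (K := K) hs]
  simpa [h0] using (tendsto_prod_one_sub_zetaTerm_mul_tsum (K := K) hs).mul_const
    (∑' I, zetaTerm K s I)⁻¹

theorem summable_zetaTerm_prime {s : ℝ} (hs : 1 < s) :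
    Summable fun p : HeightOneSpectrum (𝓞 K) ↦ zetaTerm K s p.asIdeal :=
  (summable_zetaTerm hs).comp_injective fun _ _ ↦ HeightOneSpectrum.ext

variable (K) in
theorem exists_prod_one_sub_zetaTerm_one_lt {ε : ℝ} (hε : 0 < ε) :
    ∃ P : Finset (HeightOneSpectrum (𝓞 K)), ∏ p ∈ P, (1 - zetaTerm K 1 p.asIdeal) < ε := by
  have hres := (tendsto_sub_one_mul_dedekindZeta_nhdsGT K).norm
  rw [Complex.norm_real, Real.norm_of_nonneg (dedekindZeta_residue_pos K).le] at hres
  have h1 : ∀ᶠ s : ℝ in 𝓝[>] 1, dedekindZeta_residue K / 2 < ‖((s : ℂ) - 1) * dedekindZeta K s‖ :=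
    hres.eventually_const_lt (half_lt_self (dedekindZeta_residue_pos K))
  have h2 : ∀ᶠ s : ℝ in 𝓝[>] 1, s - 1 < ε * (dedekindZeta_residue K / 2) := by
    have : Tendsto (fun s : ℝ ↦ s - 1) (𝓝[>] 1) (𝓝 0) := by
      refine tendsto_nhdsWithin_of_tendsto_nhds ?_
      simpa using (continuous_id.sub continuous_const).tendsto (f := fun s : ℝ ↦ s - 1) 1
    exact this.eventually_lt_const (mul_pos hε (half_pos (dedekindZeta_residue_pos K)))
  obtain ⟨s, hs1, hs2, hs⟩ := (h1.and (h2.and self_mem_nhdsWithin)).exists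
  have hs : 1 < s := hs
  have hZ := one_le_tsum_zetaTerm (K := K) hs
  have hlt : (∑' I, zetaTerm K s I)⁻¹ < ε := by
    rw [← tsum_zetaTerm hs, norm_mul, Complex.norm_real, ← Complex.ofReal_one,
      ← Complex.ofReal_sub, Complex.norm_real, Real.norm_of_nonneg (by linarith),
      Real.norm_of_nonneg (by linarith)] at hs1
    -- With r the residue and Z the sum, s - 1 < εr/2 < ε(s - 1)Z; dividing by s - 1 gives 1 < εZ.
    rw [inv_lt_iff_one_lt_mul₀ (by linarith)]
    have hs0 : 0 < s - 1 := by linarith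
    nlinarith
  obtain ⟨P, hP⟩ := ((tendsto_prod_one_sub_zetaTerm hs).eventually_lt_const hlt).exists
  -- P was found for an s > 1; each factor only decreases when s is lowered to 1.
  refine ⟨P, (Finset.prod_le_prod (fun p _ ↦ ?_) fun p _ ↦ ?_).trans_lt hP⟩
  · exact sub_nonneg.2 (zetaTerm_lt_one one_pos p).le
  · refine sub_le_sub_left ?_ _
    exact Real.rpow_le_rpow_of_exponent_le (by exact_mod_cast (one_lt_absNorm p).le)
      (by linarith)

end Zeta

/-! ### Tuples with a common prime outside a finite set -/

section Tail

variable {K : Type*} [Field K] [NumberField K]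

theorem exists_prime_natCast_mem (p : HeightOneSpectrum (𝓞 K)) :
    ∃ q : ℕ, q.Prime ∧ (q : 𝓞 K) ∈ p.asIdeal := by
  have h0 : Ideal.absNorm p.asIdeal ≠ 0 := by linarith [one_lt_absNorm p]
  have h := Ideal.absNorm_mem p.asIdeal
  rw [← Nat.prod_factorization_pow_eq_self h0, Finsupp.prod, Nat.cast_prod,
    p.isPrime.prod_mem_iff] at h
  obtain ⟨q, hq, hqp⟩ := h
  rw [Nat.cast_pow] at hqp
  exact ⟨q, Nat.prime_of_mem_primeFactors hq, p.isPrime.mem_of_pow_mem _ hqp⟩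

/-- The rational prime below a prime of `K`. -/
noncomputable def residuePrime (p : HeightOneSpectrum (𝓞 K)) : ℕ :=
  (exists_prime_natCast_mem p).choose

theorem prime_residuePrime (p : HeightOneSpectrum (𝓞 K)) : (residuePrime p).Prime :=
  (exists_prime_natCast_mem p).choose_spec.1

theorem residuePrime_mem (p : HeightOneSpectrum (𝓞 K)) : (residuePrime p : 𝓞 K) ∈ p.asIdeal :=
  (exists_prime_natCast_mem p).choose_spec.2

theorem residuePrime_dvd {p : HeightOneSpectrum (𝓞 K)} {a : ℤ} (ha : (a : 𝓞 K) ∈ p.asIdeal) :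
    (residuePrime p : ℤ) ∣ a := by
  by_contra h
  obtain ⟨u, v, huv⟩ :=
    (Nat.prime_iff_prime_int.1 (prime_residuePrime p)).coprime_iff_not_dvd.2 h
  refine p.isPrime.ne_top ((Ideal.eq_top_iff_one _).2 ?_)
  have : (1 : 𝓞 K) = u * (residuePrime p : 𝓞 K) + v * a := by exact_mod_cast huv.symm
  rw [this]
  exact add_mem (Ideal.mul_mem_left _ _ (residuePrime_mem p)) (Ideal.mul_mem_left _ _ ha)

theorem residuePrime_le_absNorm (p : HeightOneSpectrum (𝓞 K)) :
    residuePrime p ≤ Ideal.absNorm p.asIdeal := by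
  refine Nat.le_of_dvd (by linarith [one_lt_absNorm p]) ?_
  rw [← Int.natCast_dvd_natCast]
  exact residuePrime_dvd (by exact_mod_cast Ideal.absNorm_mem p.asIdeal)

variable (K) in
theorem finite_residuePrime_le (n : ℕ) :
    {p : HeightOneSpectrum (𝓞 K) | residuePrime p ≤ n}.Finite := by
  refine (Ideal.finite_factors (I := Ideal.span {(n.factorial : 𝓞 K)}) ?_).subset fun p hp ↦ ?_
  · simpa using n.factorial_ne_zero
  · rw [Set.mem_ofPred_eq, Ideal.dvd_span_singleton]
    obtain ⟨c, hc⟩ := Nat.dvd_factorial (prime_residuePrime p).pos hp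
    rw [hc, Nat.cast_mul]
    exact Ideal.mul_mem_right _ _ (residuePrime_mem p)

theorem finite_setOf_mem_asIdeal {x : 𝓞 K} (hx : x ≠ 0) :
    {p : HeightOneSpectrum (𝓞 K) | x ∈ p.asIdeal}.Finite := by
  simpa only [Ideal.dvd_span_singleton] using
    Ideal.finite_factors (I := Ideal.span {x}) (by simpa using hx)

variable (E : Basis (Fin (finrank ℚ K)) ℤ (𝓞 K)) {B : ℝ} {m : ℕ}

/-- Some basis element lies outside p. Its coordinate is then determined mod q by the others, hence
determined outright, since the box is at most q wide. -/
theorem card_boxIdeal_le_of_lt_residuePrime (p : HeightOneSpectrum (𝓞 K)) (hB : 0 ≤ B)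
    (hp : 2 * B ≤ residuePrime p) :
    ((boxIdeal E p.asIdeal B).card : ℝ) ≤ (2 * B + 1) ^ (finrank ℚ K - 1) := by
  classical
  obtain ⟨i, hi⟩ : ∃ i, E i ∉ p.asIdeal := by
    by_contra! h
    refine p.isPrime.ne_top ((Ideal.eq_top_iff_one _).2 ?_)
    rw [← E.sum_repr 1]
    exact sum_mem fun i _ ↦ zsmul_mem (h i) _
  have hcard : (boxIdeal E p.asIdeal B).card ≤
      (Fintype.piFinset fun _ : {j // j ≠ i} ↦ Finset.Ico ⌈-B⌉ ⌈B⌉).card := by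
    refine Finset.card_le_card_of_injOn (fun x j ↦ E.repr x j) (fun x hx ↦ ?_) fun x hx y hy hxy ↦ ?_
    · exact Fintype.mem_piFinset.2 fun j ↦
        (mem_boxFinset E).1 ((mem_boxIdeal E).1 hx).1 j
    · obtain ⟨hx, hxp⟩ := (mem_boxIdeal E).1 hx
      obtain ⟨hy, hyp⟩ := (mem_boxIdeal E).1 hy
      have hne (j) (hj : j ≠ i) : E.repr x j = E.repr y j := congrFun hxy ⟨j, hj⟩
      have hsub : x - y = (E.repr x i - E.repr y i : ℤ) * E i := by
        rw [← E.sum_repr x, ← E.sum_repr y, ← Finset.sum_sub_distrib]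
        rw [Finset.sum_eq_single i (fun j _ hj ↦ by rw [hne j hj, sub_self]) (by simp),
          ← sub_smul, zsmul_eq_mul, E.sum_repr, E.sum_repr]
      have hmem := hsub ▸ sub_mem hxp hyp
      have hdvd := residuePrime_dvd ((p.isPrime.mem_or_mem hmem).resolve_right hi)
      have hxi := Finset.mem_Ico.1 ((mem_boxFinset E).1 hx i)
      have hyi := Finset.mem_Ico.1 ((mem_boxFinset E).1 hy i)
      rw [Int.ceil_le, Int.lt_ceil] at hxi hyi
      -- The half-open interval matters: two points of [-B, B) differ by strictly less than 2B.
      have habs : |E.repr x i - E.repr y i| < (residuePrime p : ℤ) := by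
        rw [abs_lt]
        constructor <;> · rify; linarith
      have hz := sub_eq_zero.1 (Int.eq_zero_of_abs_lt_dvd hdvd habs)
      refine E.ext_elem fun j ↦ ?_
      by_cases hj : j = i
      · rw [hj, hz]
      · exact hne j hj
  refine (Nat.cast_le.2 hcard).trans ?_
  rw [Fintype.card_piFinset, Finset.prod_const, Finset.card_univ, Nat.cast_pow]
  simp only [ne_eq, Fintype.card_subtype_compl, Fintype.card_fin, Fintype.card_subtype_eq]
  gcongr
  exact card_Ico_ceil_le hB

/-- The norm is a product over k embeddings, each at most linear in the coordinates. -/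
theorem exists_absNorm_span_le : ∃ C : ℝ, ∀ B : ℝ, 0 ≤ B → ∀ x ∈ boxFinset E B,
    (Ideal.absNorm (Ideal.span {x}) : ℝ) ≤ C * B ^ finrank ℚ K := by
  set M : ℝ := ∑ σ : K →ₐ[ℚ] ℂ, ∑ i, ‖σ (E i : K)‖
  refine ⟨M ^ finrank ℚ K, fun B hB x hx ↦ ?_⟩
  have hσ (σ : K →ₐ[ℚ] ℂ) : ‖σ (x : K)‖ ≤ M * B := by
    have hM : ∑ i, ‖σ (E i : K)‖ ≤ M :=
      Finset.single_le_sum (f := fun σ : K →ₐ[ℚ] ℂ ↦ ∑ i, ‖σ (E i : K)‖)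
        (fun _ _ ↦ by positivity) (Finset.mem_univ σ)
    refine le_trans ?_ (mul_le_mul_of_nonneg_right hM hB)
    have hx' : σ (x : K) = ∑ i, (E.repr x i : ℂ) * σ (E i : K) := by
      conv_lhs => rw [← E.sum_repr x]
      simp [zsmul_eq_mul]
    rw [hx', Finset.sum_mul]
    refine (norm_sum_le _ _).trans (Finset.sum_le_sum fun i _ ↦ ?_)
    rw [norm_mul, mul_comm, Complex.norm_intCast]
    gcongr
    have := Finset.mem_Ico.1 ((mem_boxFinset E).1 hx i)
    rw [Int.ceil_le, Int.lt_ceil] at this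
    exact abs_le.2 ⟨this.1, this.2.le⟩
  have hnorm : ((Ideal.absNorm (Ideal.span {x}) : ℕ) : ℝ) = ∏ σ : K →ₐ[ℚ] ℂ, ‖σ (x : K)‖ := by
    rw [← norm_prod, ← Algebra.norm_eq_prod_embeddings, ← Algebra.coe_norm_int,
      Ideal.absNorm_span_singleton]
    simp [Nat.cast_natAbs]
  rw [hnorm, ← mul_pow]
  refine (Finset.prod_le_prod (fun _ _ ↦ norm_nonneg _) fun σ _ ↦ hσ σ).trans ?_
  rw [Finset.prod_const, Finset.card_univ, AlgHom.card]

/-- More than k such primes would force N(x) ≥ (2B)^(k+1), against N(x) ≤ C B^k once B > C. -/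
theorem eventually_card_le_finrank : ∀ᶠ B : ℝ in atTop, ∀ x ∈ boxFinset E B, x ≠ 0 →
    ∀ Q : Finset (HeightOneSpectrum (𝓞 K)),
      (∀ p ∈ Q, x ∈ p.asIdeal ∧ 2 * B ≤ residuePrime p) → Q.card ≤ finrank ℚ K := by
  obtain ⟨C, hC⟩ := exists_absNorm_span_le E
  filter_upwards [eventually_ge_atTop 1, eventually_gt_atTop C] with B hB hBC x hx hx0 Q hQ
  by_contra! hcard
  have hdvd : ∏ p ∈ Q, p.asIdeal ∣ Ideal.span {x} := by
    rw [Ideal.dvd_span_singleton, mem_prod_asIdeal_iff]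
    exact fun p hp ↦ (hQ p hp).1
  have h0 : 0 < Ideal.absNorm (Ideal.span {x}) :=
    Nat.pos_of_ne_zero (by simpa [Ideal.absNorm_eq_zero_iff] using hx0)
  have h1 : ((∏ p ∈ Q, Ideal.absNorm p.asIdeal : ℕ) : ℝ) ≤ Ideal.absNorm (Ideal.span {x}) := by
    rw [Nat.cast_le, ← map_prod]
    exact Nat.le_of_dvd h0 (map_dvd _ hdvd)
  have h2 : (2 * B) ^ Q.card ≤ ((∏ p ∈ Q, Ideal.absNorm p.asIdeal : ℕ) : ℝ) := by
    rw [Nat.cast_prod, ← Finset.prod_const]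
    refine Finset.prod_le_prod (fun _ _ ↦ by linarith) fun p hp ↦ (hQ p hp).2.trans ?_
    exact_mod_cast residuePrime_le_absNorm p
  have h3 : (2 * B) ^ (finrank ℚ K + 1) ≤ (2 * B) ^ Q.card :=
    pow_le_pow_right₀ (by linarith) hcard
  have h4 := ((h3.trans h2).trans h1).trans (hC B (by linarith) x hx)
  have h5 : B ^ (finrank ℚ K + 1) ≤ (2 * B) ^ (finrank ℚ K + 1) := by gcongr; linarith
  have h6 : C * B ^ finrank ℚ K < B ^ (finrank ℚ K + 1) := by
    rw [pow_succ']; gcongr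
  linarith

theorem tendsto_mul_pow_div_pow_zero (c : ℝ) {a b : ℕ} (hab : a < b) :
    Tendsto (fun B : ℝ ↦ c * (2 * B + 1) ^ a / (2 * B) ^ b) atTop (𝓝 0) := by
  obtain ⟨d, rfl⟩ := Nat.exists_eq_add_of_lt hab
  have h1 : Tendsto (fun B : ℝ ↦ 2 * B) atTop atTop := tendsto_id.const_mul_atTop two_pos
  have h2 : Tendsto (fun B : ℝ ↦ (2 * B)⁻¹) atTop (𝓝 0) := tendsto_inv_atTop_zero.comp h1
  have h3 := (((h2.const_add 1).pow a).const_mul c).mul (h2.pow (d + 1))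
  simp only [add_zero, one_pow, ne_eq, Nat.succ_ne_zero, not_false_eq_true, zero_pow,
    mul_zero] at h3
  refine h3.congr' ?_
  filter_upwards [eventually_gt_atTop 0] with B hB
  rw [add_assoc, pow_add, show 1 + (2 * B)⁻¹ = (2 * B + 1) / (2 * B) by field_simp, div_pow, inv_pow]
  field_simp
  ring

theorem tendsto_boxRatio_head_eq_zero :
    Tendsto (boxRatio E {x : Fin (m + 1) → 𝓞 K | x 0 = 0}) atTop (𝓝 0) := by
  classical
  have hk : 0 < finrank ℚ K := finrank_pos
  have hlt : finrank ℚ K * m < (m + 1) * finrank ℚ K := by nlinarith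
  refine tendsto_of_tendsto_of_tendsto_of_le_of_le' tendsto_const_nhds
    (tendsto_mul_pow_div_pow_zero 1 hlt)
    ((eventually_ge_atTop 0).mono fun B hB ↦ boxRatio_nonneg E _ hB) ?_
  filter_upwards [eventually_ge_atTop 0] with B hB
  refine (boxRatio_le_card_div E
    (Fintype.piFinset (Fin.cons {0} fun _ ↦ boxFinset E B : Fin (m + 1) → Finset (𝓞 K)))
    ?_ hB).trans ?_
  · intro x hx h0
    refine Fintype.mem_piFinset.2 (Fin.cases ?_ fun j ↦ ?_)
    · simpa using h0
    · simpa using (mem_boxTuples E).1 hx j.succ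
  rw [one_mul]
  gcongr
  rw [Fintype.card_piFinset, Fin.prod_univ_succ]
  simp only [Fin.cons_zero, Fin.cons_succ, Finset.card_singleton, one_mul, Finset.prod_const,
    Finset.card_univ, Fintype.card_fin, Nat.cast_pow, pow_mul]
  gcongr
  exact card_boxFinset_le E hB

theorem exists_tendsto_zero_boxRatio_large_residuePrime_le (hm : 1 ≤ m) :
    ∃ V : ℝ → ℝ, Tendsto V atTop (𝓝 0) ∧ ∀ᶠ B : ℝ in atTop,
      boxRatio E {x : Fin (m + 1) → 𝓞 K | x 0 ≠ 0 ∧ ∃ p : HeightOneSpectrum (𝓞 K),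
        2 * B ≤ residuePrime p ∧ ∀ j, x j ∈ p.asIdeal} B ≤ V B := by
  classical
  have hk : 0 < finrank ℚ K := finrank_pos
  -- The first entry is free (exponent k), each of the other m loses one power; m ≥ 1 makes the
  -- inequality strict.
  have hlt : finrank ℚ K + (finrank ℚ K - 1) * m < (m + 1) * finrank ℚ K := by
    obtain ⟨k, hk'⟩ := Nat.exists_eq_add_of_lt hk
    rw [hk']
    simp only [zero_add, Nat.add_sub_cancel]
    nlinarith
  refine ⟨_, tendsto_mul_pow_div_pow_zero (finrank ℚ K) hlt, ?_⟩
  filter_upwards [eventually_ge_atTop 0, eventually_card_le_finrank E] with B hB hQ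
  have hF (y : 𝓞 K) : ∃ F : Finset (HeightOneSpectrum (𝓞 K)),
      ∀ p, p ∈ F ↔ y ≠ 0 ∧ y ∈ p.asIdeal ∧ 2 * B ≤ residuePrime p := by
    rcases eq_or_ne y 0 with rfl | hy
    · exact ⟨∅, by simp⟩
    · exact ⟨{p ∈ (finite_setOf_mem_asIdeal hy).toFinset | 2 * B ≤ residuePrime p}, by simp [hy]⟩
  choose F hF using hF
  have hFcard (y) (hy : y ∈ boxFinset E B) : (F y).card ≤ finrank ℚ K := by
    rcases (F y).eq_empty_or_nonempty with h | ⟨p, hp⟩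
    · simp [h]
    · exact hQ y hy ((hF y p).1 hp).1 _ fun p hp ↦ ((hF y p).1 hp).2
  let T (y : 𝓞 K) (p : HeightOneSpectrum (𝓞 K)) : Finset (Fin (m + 1) → 𝓞 K) :=
    Fintype.piFinset (Fin.cons {y} fun _ ↦ boxIdeal E p.asIdeal B)
  have hT (y p) (hp : p ∈ F y) : ((T y p).card : ℝ) ≤ (2 * B + 1) ^ ((finrank ℚ K - 1) * m) := by
    simp only [T, Fintype.card_piFinset, Fin.prod_univ_succ, Fin.cons_zero, Fin.cons_succ,
      Finset.card_singleton, one_mul, Finset.prod_const, Finset.card_univ, Fintype.card_fin,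
      Nat.cast_pow, pow_mul]
    gcongr
    exact card_boxIdeal_le_of_lt_residuePrime E p hB ((hF y p).1 hp).2.2
  refine (boxRatio_le_card_div E ((boxFinset E B).biUnion fun y ↦ (F y).biUnion (T y))
    ?_ hB).trans ?_
  · rintro x hx ⟨h0, p, hp, hxp⟩
    rw [mem_boxTuples] at hx
    simp only [Finset.mem_biUnion]
    refine ⟨x 0, hx 0, p, (hF _ p).2 ⟨h0, hxp 0, hp⟩, Fintype.mem_piFinset.2 ?_⟩
    refine Fin.cases ?_ fun j ↦ ?_
    · simp
    · simpa [mem_boxIdeal] using ⟨hx j.succ, hxp j.succ⟩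
  gcongr
  refine (Nat.cast_le.2 (Finset.card_biUnion_le.trans
    (Finset.sum_le_sum fun y _ ↦ Finset.card_biUnion_le))).trans ?_
  push_cast
  calc ∑ y ∈ boxFinset E B, ∑ p ∈ F y, ((T y p).card : ℝ)
      ≤ ∑ y ∈ boxFinset E B, (finrank ℚ K) * (2 * B + 1) ^ ((finrank ℚ K - 1) * m) := by
        refine Finset.sum_le_sum fun y hy ↦ (Finset.sum_le_card_nsmul _ _ _ (hT y)).trans ?_
        rw [nsmul_eq_mul]
        gcongr
        exact hFcard y hy
    _ ≤ _ := by
        rw [Finset.sum_const, nsmul_eq_mul, pow_add, mul_left_comm]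
        gcongr
        exact card_boxFinset_le E hB

theorem boxRatio_small_residuePrime_le (hm : 2 ≤ m) (P : Finset (HeightOneSpectrum (𝓞 K)))
    (hB : 0 < B) :
    boxRatio E {x : Fin m → 𝓞 K | ∃ p ∉ P, residuePrime p ≤ 2 * B ∧ ∀ j, x j ∈ p.asIdeal} B ≤
      3 ^ (m * finrank ℚ K) *
        ∑' p : {p : HeightOneSpectrum (𝓞 K) // p ∉ P}, zetaTerm K m p.1.asIdeal := by
  classical
  set F : Finset {p : HeightOneSpectrum (𝓞 K) // p ∉ P} :=
    ((finite_residuePrime_le K ⌊2 * B⌋₊).toFinset).subtype _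
  have hF (p : {p : HeightOneSpectrum (𝓞 K) // p ∉ P}) : p ∈ F ↔ residuePrime p.1 ≤ 2 * B := by
    simp [F, Nat.le_floor_iff (by linarith : 0 ≤ 2 * B)]
  have hm' : (1 : ℝ) < m := by exact_mod_cast hm
  have hsum : ∑ p ∈ F, zetaTerm K m p.1.asIdeal ≤
      ∑' p : {p : HeightOneSpectrum (𝓞 K) // p ∉ P}, zetaTerm K m p.1.asIdeal :=
    ((summable_zetaTerm_prime hm').subtype _).sum_le_tsum F fun _ _ ↦ zetaTerm_nonneg _ _
  refine le_trans ?_ (mul_le_mul_of_nonneg_left hsum (by positivity))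
  refine (boxRatio_le_card_div E
    (F.biUnion fun p ↦ {x ∈ boxTuples E m B | ∀ j, x j ∈ p.1.asIdeal})
    ?_ hB.le).trans ?_
  · rintro x hx ⟨p, hpP, hp, hxp⟩
    exact Finset.mem_biUnion.2 ⟨⟨p, hpP⟩, (hF _).2 hp, Finset.mem_filter.2 ⟨hx, hxp⟩⟩
  rw [div_le_iff₀ (by positivity)]
  refine (Nat.cast_le.2 Finset.card_biUnion_le).trans ?_
  push_cast
  rw [mul_right_comm, ← mul_pow, Finset.mul_sum]
  refine Finset.sum_le_sum fun p hp ↦ ?_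
  rw [filter_boxTuples_forall_mem, Fintype.card_piFinset_const, Nat.cast_pow, zetaTerm_natCast,
    mul_comm m, pow_mul, ← div_eq_mul_inv, ← div_pow]
  gcongr
  refine (card_boxIdeal_le E p.1.ne_bot (prime_residuePrime p.1).pos (residuePrime_mem p.1)
    hB.le).trans ?_
  gcongr
  -- Source of the constant 3: 2B + 2q ≤ 6B = 3 · 2B when q ≤ 2B.
  linarith [(hF p).1 hp]

end Tail

/-! ### Assembling the densities -/

section Main

variable {K : Type*} [Field K] [NumberField K] (E : Basis (Fin (finrank ℚ K)) ℤ (𝓞 K))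

theorem coprimeTo_subset (P : Finset (HeightOneSpectrum (𝓞 K))) (m : ℕ) (B : ℝ) :
    coprimeTo P (m + 1) ⊆ coprimeTuples K (m + 1) ∪
      ({x | ∃ p ∉ P, residuePrime p ≤ 2 * B ∧ ∀ j, x j ∈ p.asIdeal} ∪ ({x | x 0 = 0} ∪
        {x | x 0 ≠ 0 ∧ ∃ p : HeightOneSpectrum (𝓞 K),
          2 * B ≤ residuePrime p ∧ ∀ j, x j ∈ p.asIdeal})) := by
  intro x hx
  by_cases hc : x ∈ coprimeTuples K (m + 1)
  · exact Or.inl hc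
  · rw [mem_coprimeTuples_iff] at hc
    push Not at hc
    obtain ⟨p, hp⟩ := hc
    rcases le_total (residuePrime p : ℝ) (2 * B) with h | h
    · exact Or.inr (Or.inl ⟨p, fun hpP ↦ hx p hpP hp, h, hp⟩)
    · by_cases h0 : x 0 = 0
      · exact Or.inr (Or.inr (Or.inl h0))
      · exact Or.inr (Or.inr (Or.inr ⟨h0, p, h, hp⟩))

theorem tendsto_boxRatio_coprimeTuples {m : ℕ} (hm : 2 ≤ m) :
    Tendsto (boxRatio E (coprimeTuples K m)) atTop (𝓝 (∑' I, zetaTerm K m I)⁻¹) := by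
  have hm' : (1 : ℝ) < m := by exact_mod_cast hm
  have hprod := tendsto_prod_one_sub_zetaTerm (K := K) hm'
  have htail := (tendsto_tsum_compl_atTop_zero
    fun p : HeightOneSpectrum (𝓞 K) ↦ zetaTerm K m p.asIdeal).const_mul
      ((3 : ℝ) ^ (m * finrank ℚ K))
  have hlow := hprod.sub htail
  rw [mul_zero, sub_zero] at hlow
  have hP (P : Finset (HeightOneSpectrum (𝓞 K))) := tendsto_boxRatio_coprimeTo E (m := m) P
  simp_rw [← zetaTerm_natCast] at hP
  refine tendsto_order.2 ⟨fun a ha ↦ ?_, fun a ha ↦ ?_⟩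
  -- P is fixed first, so that the product minus the tail bound exceeds a; the remaining two error
  -- terms vanish as B grows.
  · obtain ⟨P, hPa⟩ := (hlow.eventually_const_lt ha).exists
    obtain ⟨m, rfl⟩ : ∃ n, m = n + 1 := ⟨m - 1, by omega⟩
    obtain ⟨V, hV0, hV⟩ := exists_tendsto_zero_boxRatio_large_residuePrime_le E (m := m) (by omega)
    have hlim := ((hP P).sub_const ((3 : ℝ) ^ ((m + 1) * finrank ℚ K) *
      ∑' p : {p : HeightOneSpectrum (𝓞 K) // p ∉ P}, zetaTerm K (m + 1 : ℕ) p.1.asIdeal)).sub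
      ((tendsto_boxRatio_head_eq_zero E (m := m)).add hV0)
    rw [add_zero, sub_zero] at hlim
    filter_upwards [hlim.eventually_const_lt hPa, hV, eventually_gt_atTop 0] with B h1 h2 hB
    have h3 := boxRatio_mono E (coprimeTo_subset P m B) hB.le
    have h4 := h3.trans (boxRatio_union_le E _ _ hB.le)
    have h5 := h4.trans (add_le_add_right (boxRatio_union_le E _ _ hB.le) _)
    have h6 := h5.trans (add_le_add_right (add_le_add_right (boxRatio_union_le E _ _ hB.le) _) _)
    have h7 := boxRatio_small_residuePrime_le E hm P hB
    linarith
  · obtain ⟨P, hPa⟩ := (hprod.eventually_lt_const ha).exists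
    filter_upwards [(hP P).eventually_lt_const hPa, eventually_ge_atTop 0] with B h1 hB
    exact (boxRatio_mono E (coprimeTuples_subset P) hB).trans_lt h1

theorem tendsto_boxRatio_coprimeTuples_one :
    Tendsto (boxRatio E (coprimeTuples K 1)) atTop (𝓝 0) := by
  refine tendsto_order.2 ⟨fun a ha ↦ ?_, fun a ha ↦ ?_⟩
  · filter_upwards [eventually_ge_atTop 0] with B hB
    exact ha.trans_le (boxRatio_nonneg E _ hB)
  · obtain ⟨P, hP⟩ := exists_prod_one_sub_zetaTerm_one_lt K ha
    have h := tendsto_boxRatio_coprimeTo E (m := 1) P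
    simp_rw [← zetaTerm_natCast, Nat.cast_one] at h
    filter_upwards [h.eventually_lt_const hP, eventually_ge_atTop 0] with B h1 hB
    exact (boxRatio_mono E (coprimeTuples_subset P) hB).trans_lt h1

theorem hasDensity_of_tendsto {m : ℕ} {S : Set (Fin m → 𝓞 K)} {d : ℝ}
    (h : ∀ E : Basis (Fin (finrank ℚ K)) ℤ (𝓞 K), Tendsto (boxRatio E S) atTop (𝓝 d)) :
    HasDensity S d :=
  fun E ↦ ⟨(h E).limsup_eq, (h E).liminf_eq⟩

end Main

end AlgebraicIntegerDensity

theorem mainTheorem2 (K : Type*) [Field K] [NumberField K] :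
    (∀ m : ℕ, 2 ≤ m →
      dedekindZeta K (m : ℂ) ≠ 0 ∧
      ∃ d : ℝ, (d : ℂ) = 1 / dedekindZeta K (m : ℂ) ∧
        AlgebraicIntegerDensity.HasDensity (AlgebraicIntegerDensity.coprimeTuples K m) d) ∧
    AlgebraicIntegerDensity.HasDensity (AlgebraicIntegerDensity.coprimeTuples K 1) 0 := by
  refine ⟨fun m hm ↦ ?_,
    AlgebraicIntegerDensity.hasDensity_of_tendsto fun E ↦
      AlgebraicIntegerDensity.tendsto_boxRatio_coprimeTuples_one E⟩
  have hm' : (1 : ℝ) < m := by exact_mod_cast hm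
  have hZ := AlgebraicIntegerDensity.tsum_zetaTerm (K := K) hm'
  rw [Complex.ofReal_natCast] at hZ
  rw [← hZ]
  refine ⟨?_, _, ?_, AlgebraicIntegerDensity.hasDensity_of_tendsto fun E ↦
    AlgebraicIntegerDensity.tendsto_boxRatio_coprimeTuples E hm⟩
  · rw [Complex.ofReal_ne_zero]
    linarith [AlgebraicIntegerDensity.one_le_tsum_zetaTerm (K := K) hm']
  · push_cast
    rw [one_div]
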